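/- Conventions. All alphabets are finite unless stated otherwise; a class of languages $\mathcal{C}$ is a collection of languages over finite alphabets. It is an AFL if it is closed under homomorphism, inverse homomorphism, intersection with regular languages, union, concatenation and the Kleene star, and it is reversal-closed if $L \in \mathcal{C}$ implies $L^{\mathrm{rev}} \in \mathcal{C}$. A rewriting system $\mathcal{R} \subseteq A^* \times A^*$ is monadic if $|u| \geq |v|$ and $v \in A \cup \{\varepsilon\}$ for all $(u,v) \in \mathcal{R}$; it is a monadic $\mathcal{C}$-rewriting system if moreover $\{u \mid (u,a) \in \mathcal{R}\} \in \mathcal{C}$ for every $a \in A \cup \{\varepsilon\}$. A super-AFL is an AFL $\mathcal{C}$ with the monadic ancestor property: for every monadic $\mathcal{C}$-rewriting system $\mathcal{R}$ on any alphabet $A$ and every $L \subseteq A^*$ with $L \in \mathcal{C}$, the set of all words in $A^*$ which can be rewritten under $\mathcal{R}$, in finitely many (possibly zero) steps, to a word of $L$ is in $\mathcal{C}$. A monoid $M$ has word problem in $\mathcal{C}$ if for some finite generating set $B$ of $M$ (with $\# \notin B$) the language $\{u \# v^{\mathrm{rev}} \mid u, v \in B^*,\ u =_M v\}$ is in $\mathcal{C}$;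 as $\mathcal{C}$ is closed under inverse homomorphism, this does not depend on the choice of $B$. Let $M$ be the monoid defined by a finite presentation $\langle A \mid u_i = v_i\ (1 \leq i \leq p)\rangle$ which is weakly compressible with respect to $\alpha$; that is, $\alpha \in A^+$ is a word none of whose proper non-empty prefixes is also a suffix of $\alpha$, and $u_i, v_i \in \alpha A^* \cap A^*\alpha$ for all $i$. Let $\Sigma_* = \alpha(A^* - A^*\alpha A^*)$, let $\Gamma_* = \{\gamma_w \mid w \in \Sigma_*\}$ be a (possibly infinite) set of symbols in bijection with $\Sigma_*$, and let $\varphi \colon \Sigma_*^* \to \Gamma_*^*$ be the isomorphism of free monoids with $w \mapsto \gamma_w$ for $w \in \Sigma_*$. Write $u_i = u_i'\alpha$ and $v_i = v_i'\alpha$ with $u_i', v_i' \in \Sigma_*^*$, and let $\Gamma$ be the finite set of symbols of $\Gamma_*$ that occur in some $\varphi(u_i')$ or $\varphi(v_i')$. The left monoid $L(M)$ is the submonoid generated by $\Gamma$ of the monoid defined by the presentation $\langle \Gamma_* \mid \varphi(u_i') = \varphi(v_i')\ (1 \leq i \leq p)\rangle$. Theorem. Let $M$ and $L(M)$ be as above,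 and let $\mathcal{C}$ be a reversal-closed super-AFL. Then $M$ has word problem in $\mathcal{C}$ if and only if $L(M)$ has word problem in $\mathcal{C}$. -/

import Mathlib

namespace WeakCompression

/-! ### Classes of languages -/

/-- A class of languages: a collection of languages over each finite alphabet. -/
abbrev LanguageClass : Type 1 := ∀ (A : Type) [Finite A], Set (Language A)

/-- The image of a language under the monoid homomorphism `A* → B*` that extends `f`. -/
def homImage {A B : Type} (f : A → List B) (L : Language A) : Language B :=
  {w | ∃ v ∈ L, v.flatMap f = w}

/-- The preimage of a language under the monoid homomorphism `A* → B*` that extends `f`. -/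
def homPreimage {A B : Type} (f : A → List B) (L : Language B) : Language A :=
  {v | v.flatMap f ∈ L}

/-- An abstract family of languages: a class closed under homomorphism, inverse homomorphism,
intersection with regular languages, union, concatenation and the Kleene star. -/
structure IsAFL (C : LanguageClass) : Prop where
  hom : ∀ {A B : Type} [Finite A] [Finite B] (f : A → List B) (L : Language A),
    L ∈ C A → homImage f L ∈ C B
  inverse_hom : ∀ {A B : Type} [Finite A] [Finite B] (f : A → List B) (L : Language B),
    L ∈ C B → homPreimage f L ∈ C A
  inter_regular : ∀ {A : Type} [Finite A] (L K : Language A),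
    L ∈ C A → K.IsRegular → L ⊓ K ∈ C A
  union : ∀ {A : Type} [Finite A] (L K : Language A), L ∈ C A → K ∈ C A → L + K ∈ C A
  concat : ∀ {A : Type} [Finite A] (L K : Language A), L ∈ C A → K ∈ C A → L * K ∈ C A
  star : ∀ {A : Type} [Finite A] (L : Language A), L ∈ C A → KStar.kstar L ∈ C A

/-- A class of languages is reversal-closed if it contains the reversal of each member. -/
def ReversalClosed (C : LanguageClass) : Prop :=
  ∀ {A : Type} [Finite A] (L : Language A), L ∈ C A → L.reverse ∈ C A

/-! ### Rewriting systems and super-AFLs -/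

/-- One rewriting step `x ℓ y → x r y` with `(ℓ, r)` a rule of `R`. -/
def Step {A : Type} (R : Set (List A × List A)) (u v : List A) : Prop :=
  ∃ x y l r : List A, (l, r) ∈ R ∧ u = x ++ l ++ y ∧ v = x ++ r ++ y

/-- The words that can be rewritten under `R`, in finitely many (perhaps no) steps, to a word
of `L`. -/
def ancestors {A : Type} (R : Set (List A × List A)) (L : Language A) : Language A :=
  {w | ∃ x ∈ L, Relation.ReflTransGen (Step R) w x}

/-- In a monadic system each rule `(u, v)` has `|u| ≥ |v|`, and `v` is a letter or empty. -/
def Monadic {A : Type} (R : Set (List A × List A)) : Prop :=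
  ∀ u v : List A, (u, v) ∈ R → v.length ≤ u.length ∧ v.length ≤ 1

/-- A monadic system is a `C`-system if, for every `a` which is a letter or empty, the language
of left-hand sides of the rules with right-hand side `a` is in `C`. -/
def IsMonadicSystemIn (C : LanguageClass) {A : Type} [Finite A]
    (R : Set (List A × List A)) : Prop :=
  Monadic R ∧ ∀ a : List A, a.length ≤ 1 → ({u | (u, a) ∈ R} : Language A) ∈ C A

/-- `R` is `C`-ancestry preserving if `C` is closed under taking ancestors under `R`. -/
def AncestryPreserving (C : LanguageClass) {A : Type} [Finite A]
    (R : Set (List A × List A)) : Prop :=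
  ∀ L : Language A, L ∈ C A → ancestors R L ∈ C A

/-- Every monadic `C`-rewriting system is `C`-ancestry preserving. -/
def MonadicAncestorProperty (C : LanguageClass) : Prop :=
  ∀ {A : Type} [Finite A] (R : Set (List A × List A)),
    IsMonadicSystemIn C R → AncestryPreserving C R

/-- A super-AFL is an AFL with the monadic ancestor property. -/
structure IsSuperAFL (C : LanguageClass) : Prop where
  isAFL : IsAFL C
  monadicAncestorProperty : MonadicAncestorProperty C

/-! ### The word problem -/

/-- The word problem `{u # vʳᵉᵛ | u, v ∈ B*, π u = π v}` of a monoid with respect to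
`π : B* → M`; the new symbol `#` is `none : Option B`. -/
def wordProblem {B : Type} {M : Type*} [Monoid M] (π : FreeMonoid B →* M) :
    Language (Option B) :=
  {w | ∃ u v : List B, π (FreeMonoid.ofList u) = π (FreeMonoid.ofList v) ∧
    w = u.map some ++ [none] ++ v.reverse.map some}

/-- `M` has word problem in `C`: for some finite generating set (that is, some surjective
homomorphism `B* → M` with `B` finite) the word problem is in `C`. -/
def HasWordProblemIn (C : LanguageClass) (M : Type*) [Monoid M] : Prop :=
  ∃ (B : Type) (_ : Finite B) (π : FreeMonoid B →* M),
    Function.Surjective π ∧ wordProblem π ∈ C (Option B)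

/-! ### Weak compression -/

/-- The monoid `Mon⟨A | u = v for (u, v) ∈ R⟩`. -/
abbrev PresMonoid {A : Type} (R : Set (List A × List A)) : Type :=
  PresentedMonoid (fun x y : FreeMonoid A => (x.toList, y.toList) ∈ R)

/-- No proper non-empty prefix of `w` is also a suffix of `w`. -/
def SelfOverlapFree {A : Type} (w : List A) : Prop :=
  ∀ x : List A, x ≠ [] → x ≠ w → x <+: w → ¬ x <:+ w

/-- The pair `(u, v)` is sealed by `w`: both words lie in `wA* ∩ A*w`. -/
def SealedBy {A : Type} (w u v : List A) : Prop :=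
  (w <+: u ∧ w <:+ u) ∧ (w <+: v ∧ w <:+ v)

/-- The presentation `⟨A | R⟩` is weakly compressible with respect to `α`. -/
structure WeaklyCompressible {A : Type} (R : Set (List A × List A)) (α : List A) : Prop where
  ne_nil : α ≠ []
  selfOverlapFree : SelfOverlapFree α
  sealed_rel : ∀ u v : List A, (u, v) ∈ R → SealedBy α u v

/-- `Σ_* = α (A* - A* α A*)`. -/
def SigmaStar {A : Type} (α : List A) : Set (List A) :=
  {w | ∃ x : List A, w = α ++ x ∧ ¬ α <:+: x}

/-- The symbols `γ_w`, one for every `w ∈ Σ_*`. -/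
abbrev GammaStar {A : Type} (α : List A) : Type := {w : List A // w ∈ SigmaStar α}

/-- The homomorphism `γ_w ↦ w` from words over the symbols `γ_w` to words over `A`; it is the
inverse of `φ`. -/
def expand {A : Type} {α : List A} (x : List (GammaStar α)) : List A :=
  x.flatMap Subtype.val

/-- The extended left monoid: generators `γ_w` for `w ∈ Σ_*`, and, for every defining relation
`u = v`, the relation `x = y`, where `u = expand x ++ α` and `v = expand y ++ α`. -/
abbrev ExtLeftMonoid {A : Type} (R : Set (List A × List A)) (α : List A) : Type :=
  PresMonoid {p : List (GammaStar α) × List (GammaStar α) |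
    (expand p.1 ++ α, expand p.2 ++ α) ∈ R}

/-- `γ_w ∈ Γ`, that is, `w` is a left piece: a factor in the factorisation over `Σ_*` of `u'`,
where `u' α` is one of the two sides of a defining relation. -/
def IsLeftPiece {A : Type} (R : Set (List A × List A)) (α : List A) (g : GammaStar α) : Prop :=
  ∃ (u v : List A) (x : List (GammaStar α)),
    (u, v) ∈ R ∧ (u = expand x ++ α ∨ v = expand x ++ α) ∧ g ∈ x

/-- The left monoid: the submonoid of the extended left monoid generated by `Γ`. -/
def leftMonoid {A : Type} (R : Set (List A × List A)) (α : List A) :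
    Submonoid (ExtLeftMonoid R α) :=
  Submonoid.closure (PresentedMonoid.of _ '' {g | IsLeftPiece R α g})

end WeakCompression

/-!
# Word problems of weakly compressible monoids

Since `α` has no self-overlaps, every word is uniquely `p · w₁ ⋯ wₙ` with `p` free of `α` and
`wᵢ ∈ Σ_*` (`factorisation_unique`). A defining relation of `M` changes neither `p` nor `wₙ`, and
acts on `w₁ ⋯ wₙ₋₁` as a defining relation of the extended left monoid does
(`exists_factorisation_of_presMk_eq`). Hence `x = y` in the extended left monoid if and only if
`xα = yα` in `M` (`presMk_expand_eq_iff`), and an inverse homomorphism, up to marking the two sides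
of `#`, carries the word problem of `M` to that of `L(M)`.

Conversely, the extended left monoid is the free product of `L(M)` and the free monoid on the
symbols outside `Γ`; its normal forms are the `blockForm`s. Let `x = u₀ (αz₁) u₁ ⋯ (αzₖ) uₖ` with
`uᵢ ∈ Γ*` and `αzᵢ ∉ Γ`. Then `xα` is the product `(u₀α) z₁ (u₁α) ⋯ zₖ (uₖα)`, so a word over `A`
equal to it in `M` arises by changing each `uᵢ` within its class in `L(M)`. Consequently equality
in `M`, as a submonoid of `A* × A*`, is generated by the pairs `(a, a)` with `a ∈ A` and the pairs
`(uα, vα)` with `u = v` in `L(M)` (`presMk_eq_iff_pairStar`). If the language of all `p # qʳᵉᵛ`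
with `(p, q)` in a set `ρ` of pairs is in a super-AFL, then so is the language of the submonoid
generated by `ρ`: it is the set of ancestors of `#` under the monadic rules `p # qʳᵉᵛ → #`
(`ancestors_pairLanguage`).
-/

namespace WeakCompression

/-! ### Languages of pairs of words -/

section PairLanguages

variable {B B' : Type}

/-- The word `u # vʳᵉᵛ`, where `#` is `none`. -/
def pairWord (u v : List B) : List (Option B) :=
  u.map some ++ none :: v.reverse.map some

/-- The language `{u # vʳᵉᵛ | (u, v) ∈ ρ}` encoding a set `ρ` of pairs of words. -/
def pairLanguage (ρ : Set (List B × List B)) : Language (Option B) :=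
  {w | ∃ u v : List B, (u, v) ∈ ρ ∧ w = pairWord u v}

/-- The word `u # vʳᵉᵛ` in which the letters to the left of `#` are tagged by `false` and those to
the right of it by `true`. -/
def markedWord (u v : List B) : List (Option (Bool × B)) :=
  u.map (fun b => some (false, b)) ++ none :: v.reverse.map (fun b => some (true, b))

/-- The encoding of a set of pairs of words by marked words; a homomorphism can act in different
ways on the two components. -/
def markedLanguage (ρ : Set (List B × List B)) : Language (Option (Bool × B)) :=
  {w | ∃ u v : List B, (u, v) ∈ ρ ∧ w = markedWord u v}

theorem wordProblem_eq_pairLanguage {M : Type*} [Monoid M] (π : FreeMonoid B →* M) :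
    wordProblem π =
      pairLanguage {p | π (FreeMonoid.ofList p.1) = π (FreeMonoid.ofList p.2)} := by
  simp only [wordProblem, pairLanguage, pairWord, List.append_assoc, List.singleton_append]
  rfl

theorem append_none_inj {u u' v v' : List B}
    (h : u.map some ++ none :: v.map some = u'.map some ++ none :: v'.map some) :
    u = u' ∧ v = v' := by
  induction u generalizing u' with
  | nil =>
    cases u' with
    | nil => simpa [(List.map_injective_iff.2 (Option.some_injective B)).eq_iff] using h
    | cons => simp at h
  | cons a u ih =>
    cases u' with
    | nil => simp at h
    | cons a' u' =>
      simp only [List.map_cons, List.cons_append, List.cons.injEq, Option.some.injEq] at h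
      simpa [h.1] using ih h.2

theorem pairWord_inj {u u' v v' : List B} (h : pairWord u v = pairWord u' v') :
    u = u' ∧ v = v' := by
  simpa using append_none_inj h

theorem pairWord_mem_pairLanguage {ρ : Set (List B × List B)} {u v : List B} :
    pairWord u v ∈ pairLanguage ρ ↔ (u, v) ∈ ρ := by
  constructor
  · rintro ⟨u', v', h, e⟩
    obtain ⟨rfl, rfl⟩ := pairWord_inj e
    exact h
  · exact fun h => ⟨u, v, h, rfl⟩

/-- The homomorphism of marked words that applies `f` on both sides and replaces `#` by
`p # qʳᵉᵛ`. -/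
def unmark (f : B → List B') (p q : List B') : Option (Bool × B) → List (Option B')
  | none => pairWord p q
  | some (false, b) => (f b).map some
  | some (true, b) => (f b).reverse.map some

theorem flatMap_unmark (f : B → List B') (p q : List B') (u v : List B) :
    (markedWord u v).flatMap (unmark f p q) = pairWord (u.flatMap f ++ p) (v.flatMap f ++ q) := by
  have hl : ∀ u : List B, (u.map (fun b => some (false, b))).flatMap (unmark f p q) =
      (u.flatMap f).map some := by
    intro u
    induction u with
    | nil => rfl
    | cons b u ih => simp [List.flatMap_cons, ih, unmark]
  have hr : ∀ v : List B, (v.reverse.map (fun b => some (true, b))).flatMap (unmark f p q) =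
      (v.flatMap f).reverse.map some := by
    intro v
    induction v with
    | nil => rfl
    | cons b v ih =>
      simp only [List.map_reverse] at ih
      simp [List.flatMap_cons, List.flatMap_append, ih, unmark]
  rw [markedWord, List.flatMap_append, List.flatMap_cons, hl, hr]
  simp [unmark, pairWord]

/-- The automaton that recognises the marked words: it is in state `some false` before `#`, in
state `some true` after it, and in state `none` once the input is known not to be marked. -/
def markedDFA (B : Type) : DFA (Option (Bool × B)) (Option Bool) where
  step
    | some false, some (false, _) => some false
    | some false, none => some true
    | some true, some (true, _) => some true
    | _, _ => none
  start := some false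
  accept := {some true}

theorem isRegular_markedLanguage_univ :
    (markedLanguage (Set.univ : Set (List B × List B))).IsRegular := by
  refine ⟨Option Bool, inferInstance, markedDFA B, ?_⟩
  have h0 : ∀ w, (markedDFA B).evalFrom none w = none := by
    intro w
    induction w with
    | nil => rfl
    | cons a w ih => simpa [DFA.evalFrom_cons, markedDFA] using ih
  have h1 : ∀ w, (markedDFA B).evalFrom (some true) w = some true ↔
      ∃ v : List B, w = v.map (fun b => some (true, b)) := by
    intro w
    induction w with
    | nil => simp
    | cons a w ih =>
      rw [DFA.evalFrom_cons]
      rcases a with _ | ⟨_ | _, b⟩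
      · rw [show (markedDFA B).step (some true) none = none from rfl, h0]
        simp [eq_comm (b := List.map _ _), List.map_eq_cons_iff]
      · rw [show (markedDFA B).step (some true) (some (false, b)) = none from rfl, h0]
        simp [eq_comm (b := List.map _ _), List.map_eq_cons_iff]
      · rw [show (markedDFA B).step (some true) (some (true, b)) = some true from rfl, ih]
        constructor
        · rintro ⟨v, rfl⟩
          exact ⟨b :: v, rfl⟩
        · rintro ⟨_ | ⟨c, v⟩, hv⟩
          · simp at hv
          · exact ⟨v, by simp_all⟩
  have h2 : ∀ w, (markedDFA B).evalFrom (some false) w = some true ↔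
      ∃ u v : List B, w = u.map (fun b => some (false, b)) ++
        none :: v.map (fun b => some (true, b)) := by
    intro w
    induction w with
    | nil => simp
    | cons a w ih =>
      rw [DFA.evalFrom_cons]
      rcases a with _ | ⟨_ | _, b⟩
      · rw [show (markedDFA B).step (some false) none = some true from rfl, h1]
        constructor
        · rintro ⟨v, rfl⟩
          exact ⟨[], v, rfl⟩
        · rintro ⟨_ | ⟨c, u⟩, v, hv⟩
          · exact ⟨v, by simpa using hv⟩
          · simp at hv
      · rw [show (markedDFA B).step (some false) (some (false, b)) = some false from rfl, ih]
        constructor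
        · rintro ⟨u, v, rfl⟩
          exact ⟨b :: u, v, rfl⟩
        · rintro ⟨_ | ⟨c, u⟩, v, hv⟩
          · simp at hv
          · exact ⟨u, v, by simp_all⟩
      · rw [show (markedDFA B).step (some false) (some (true, b)) = none from rfl, h0]
        constructor
        · simp
        · rintro ⟨_ | ⟨c, u⟩, v, hv⟩ <;> simp at hv
  ext w
  refine Iff.trans (h2 w) ⟨?_, ?_⟩
  · rintro ⟨u, v, rfl⟩
    exact ⟨u, v.reverse, trivial, by simp [markedWord]⟩
  · rintro ⟨u, v, -, rfl⟩
    exact ⟨u, v.reverse, rfl⟩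

/-- The submonoid of `B* × B*` generated by `ρ`. -/
inductive PairStar (ρ : Set (List B × List B)) : List B → List B → Prop
  | nil : PairStar ρ [] []
  | append {u v p q : List B} : PairStar ρ u v → (p, q) ∈ ρ → PairStar ρ (u ++ p) (v ++ q)

/-- The words that the monadic system of all rules `p # qʳᵉᵛ → #` with `(p, q) ∈ ρ` can rewrite
to `#` are those in which such factors are nested around the initial `#`. -/
theorem ancestors_pairLanguage (ρ : Set (List B × List B)) :
    ancestors {r | r.1 ∈ pairLanguage ρ ∧ r.2 = [none]} (pairLanguage {([], [])}) =
      pairLanguage {x | PairStar ρ x.1 x.2} := by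
  ext w
  constructor
  · rintro ⟨_, ⟨u, v, e, rfl⟩, h⟩
    obtain ⟨rfl, rfl⟩ := Prod.mk.inj e
    induction h using Relation.ReflTransGen.head_induction_on with
    | refl => exact ⟨[], [], .nil, rfl⟩
    | head h _ ih =>
      obtain ⟨x, y, l, r, ⟨⟨p, q, hpq, rfl⟩, rfl⟩, rfl, rfl⟩ := h
      obtain ⟨u, v, huv, e⟩ := ih
      have e' : x ++ none :: y = u.map some ++ none :: v.reverse.map some := by
        simpa [pairWord] using e
      -- `#` occurs only once in the word, so `x` and `y` are free of it
      have hx : ∃ x' y' : List B, x = x'.map some ∧ y = y'.map some := by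
        clear * - e'
        induction x generalizing u with
        | nil =>
          cases u with
          | nil => exact ⟨[], v.reverse, rfl, by simpa using e'⟩
          | cons => simp at e'
        | cons a x ih =>
          cases u with
          | nil =>
            have : none ∈ v.reverse.map some := by
              rw [← (List.cons.inj e').2]
              simp
            simp at this
          | cons b u =>
            simp only [List.map_cons, List.cons_append, List.cons.injEq] at e'
            obtain ⟨x', y', rfl, rfl⟩ := ih u e'.2
            exact ⟨b :: x', y', by simp [e'.1], rfl⟩
      obtain ⟨x', y', rfl, rfl⟩ := hx
      obtain ⟨rfl, rfl⟩ := append_none_inj e'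
      exact ⟨_, _, .append huv hpq, by simp [pairWord]⟩
  · rintro ⟨u, v, h, rfl⟩
    refine ⟨_, ⟨[], [], rfl, rfl⟩, ?_⟩
    change PairStar ρ u v at h
    induction h with
    | nil => exact .refl
    | @append u v p q _ hpq ih =>
      exact .head ⟨u.map some, v.reverse.map some, pairWord p q, [none],
        ⟨⟨p, q, hpq, rfl⟩, rfl⟩, by simp [pairWord], by simp [pairWord]⟩ ih

variable [Finite B] [Finite B'] {C : LanguageClass}

/-- Substituting along `f` and appending the constants `p` and `q` pulls back sets of pairs. -/
theorem markedLanguage_comap_mem (hC : IsAFL C) {ρ : Set (List B × List B)}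
    (hρ : pairLanguage ρ ∈ C (Option B)) (f : B' → List B) (p q : List B) :
    markedLanguage {x : List B' × List B' | (x.1.flatMap f ++ p, x.2.flatMap f ++ q) ∈ ρ} ∈
      C (Option (Bool × B')) := by
  convert hC.inter_regular _ _ (hC.inverse_hom (unmark f p q) _ hρ)
    isRegular_markedLanguage_univ using 1
  ext w
  constructor
  · rintro ⟨u, v, h, rfl⟩
    refine ⟨?_, u, v, trivial, rfl⟩
    change _ ∈ pairLanguage ρ
    rwa [flatMap_unmark, pairWord_mem_pairLanguage]
  · rintro ⟨h, u, v, -, rfl⟩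
    change _ ∈ pairLanguage ρ at h
    rw [flatMap_unmark, pairWord_mem_pairLanguage] at h
    exact ⟨u, v, h, rfl⟩

theorem pairLanguage_image_mem_of_markedLanguage_mem (hC : IsAFL C)
    {ρ : Set (List B × List B)} (hρ : markedLanguage ρ ∈ C (Option (Bool × B)))
    (f : B → List B') (p q : List B') :
    pairLanguage ((fun x => (x.1.flatMap f ++ p, x.2.flatMap f ++ q)) '' ρ) ∈ C (Option B') := by
  convert hC.hom (unmark f p q) _ hρ using 1
  ext w
  constructor
  · rintro ⟨_, _, ⟨⟨u, v⟩, h, e⟩, rfl⟩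
    obtain ⟨rfl, rfl⟩ := Prod.mk.inj e
    exact ⟨_, ⟨u, v, h, rfl⟩, flatMap_unmark f p q u v⟩
  · rintro ⟨_, ⟨u, v, h, rfl⟩, rfl⟩
    exact ⟨_, _, ⟨(u, v), h, rfl⟩, flatMap_unmark f p q u v⟩

theorem pairLanguage_comap_mem (hC : IsAFL C) {ρ : Set (List B × List B)}
    (hρ : pairLanguage ρ ∈ C (Option B)) (f : B' → List B) (p q : List B) :
    pairLanguage {x : List B' × List B' | (x.1.flatMap f ++ p, x.2.flatMap f ++ q) ∈ ρ} ∈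
      C (Option B') := by
  simpa using pairLanguage_image_mem_of_markedLanguage_mem hC
    (markedLanguage_comap_mem hC hρ f p q) (fun b => [b]) [] []

theorem pairLanguage_image_mem (hC : IsAFL C) {ρ : Set (List B × List B)}
    (hρ : pairLanguage ρ ∈ C (Option B)) (f : B → List B') (p q : List B') :
    pairLanguage ((fun x => (x.1.flatMap f ++ p, x.2.flatMap f ++ q)) '' ρ) ∈ C (Option B') := by
  have h := markedLanguage_comap_mem hC hρ (fun b => [b]) [] []
  simp only [List.flatMap_singleton', List.append_nil] at h
  exact pairLanguage_image_mem_of_markedLanguage_mem hC h f p q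

theorem pairLanguage_singleton_mem (hC : IsAFL C) {ρ : Set (List B × List B)}
    (hρ : pairLanguage ρ ∈ C (Option B)) (hne : ρ.Nonempty) (p q : List B') :
    pairLanguage {(p, q)} ∈ C (Option B') := by
  have hnil : ∀ u : List B, u.flatMap (fun _ => ([] : List B')) = [] := by simp
  simpa only [hnil, List.nil_append, hne.image_const] using
    pairLanguage_image_mem hC hρ (fun _ => []) p q

theorem pairLanguage_union_mem (hC : IsAFL C) {ρ σ : Set (List B × List B)}
    (hρ : pairLanguage ρ ∈ C (Option B)) (hσ : pairLanguage σ ∈ C (Option B)) :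
    pairLanguage (ρ ∪ σ) ∈ C (Option B) := by
  convert hC.union _ _ hρ hσ using 1
  ext w
  constructor
  · rintro ⟨u, v, h | h, rfl⟩
    · exact Or.inl ⟨u, v, h, rfl⟩
    · exact Or.inr ⟨u, v, h, rfl⟩
  · rintro (⟨u, v, h, rfl⟩ | ⟨u, v, h, rfl⟩)
    · exact ⟨u, v, Or.inl h, rfl⟩
    · exact ⟨u, v, Or.inr h, rfl⟩

theorem pairLanguage_union_finite_mem (hC : IsAFL C) {ρ σ : Set (List B × List B)}
    (hρ : pairLanguage ρ ∈ C (Option B)) (hne : ρ.Nonempty) (hσ : σ.Finite) :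
    pairLanguage (ρ ∪ σ) ∈ C (Option B) := by
  induction σ, hσ using Set.Finite.induction_on with
  | empty => simpa using hρ
  | @insert x σ _ _ ih =>
    rw [Set.insert_eq, Set.union_left_comm]
    exact pairLanguage_union_mem hC (pairLanguage_singleton_mem hC hρ hne x.1 x.2) ih

theorem pairLanguage_pairStar_mem (hC : IsSuperAFL C) {ρ : Set (List B × List B)}
    (hρ : pairLanguage ρ ∈ C (Option B)) (hne : ρ.Nonempty) :
    pairLanguage {x | PairStar ρ x.1 x.2} ∈ C (Option B) := by
  rw [← ancestors_pairLanguage]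
  refine hC.monadicAncestorProperty _ ⟨?_, ?_⟩ _
    (pairLanguage_singleton_mem hC.isAFL hρ hne [] [])
  · rintro _ _ ⟨⟨p, q, -, rfl⟩, rfl⟩
    simp only [pairWord, List.length_append, List.length_cons, List.length_nil]
    omega
  · intro a _
    by_cases ha : a = [none]
    · have he : ({u | (u, a) ∈ {r : List (Option B) × List (Option B) |
          r.1 ∈ pairLanguage ρ ∧ r.2 = [none]}} : Language (Option B)) = pairLanguage ρ := by
        ext w
        exact and_iff_left ha
      rwa [he]
    · have he : ({u | (u, a) ∈ {r : List (Option B) × List (Option B) |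
          r.1 ∈ pairLanguage ρ ∧ r.2 = [none]}} : Language (Option B)) = pairLanguage ρ ⊓ ⊥ := by
        ext w
        exact iff_of_false (fun h => ha h.2) (fun h => h.2)
      rw [he]
      exact hC.isAFL.inter_regular _ _ hρ
        ⟨Unit, inferInstance, ⟨fun _ _ => (), (), ∅⟩, rfl⟩

end PairLanguages

/-! ### Equality in a presented monoid -/

section Presented

variable {A : Type}

/-- The element of `Mon⟨A | R⟩` that the word `u` represents. -/
def presMk (R : Set (List A × List A)) (u : List A) : PresMonoid R :=
  PresentedMonoid.mk _ (FreeMonoid.ofList u)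

theorem presMk_nil (R : Set (List A × List A)) : presMk R [] = 1 := rfl

theorem presMk_append (R : Set (List A × List A)) (u v : List A) :
    presMk R (u ++ v) = presMk R u * presMk R v := rfl

theorem presMk_flatMap (R : Set (List A × List A)) {B : Type} (f : B → List A) (u : List B) :
    presMk R (u.flatMap f) = (u.map fun b => presMk R (f b)).prod := by
  induction u with
  | nil => rfl
  | cons b u ih => rw [List.flatMap_cons, presMk_append, ih, List.map_cons, List.prod_cons]

theorem presMk_eq_of_step {R : Set (List A × List A)} {u v : List A} (h : Step R u v) :
    presMk R u = presMk R v := by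
  obtain ⟨x, y, l, r, hlr, rfl, rfl⟩ := h
  have : presMk R l = presMk R r := PresentedMonoid.mk_eq_mk_of_rel hlr
  rw [presMk_append, presMk_append, presMk_append, presMk_append, this]

theorem eqvGen_step_append {R : Set (List A × List A)} {u v : List A} (x y : List A)
    (h : Relation.EqvGen (Step R) u v) :
    Relation.EqvGen (Step R) (x ++ u ++ y) (x ++ v ++ y) := by
  induction h with
  | rel u v h =>
    obtain ⟨p, q, l, r, hlr, rfl, rfl⟩ := h
    exact .rel _ _ ⟨x ++ p, q ++ y, l, r, hlr, by simp, by simp⟩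
  | refl => exact .refl _
  | symm _ _ _ ih => exact .symm _ _ ih
  | trans _ _ _ _ _ ih ih' => exact .trans _ _ _ ih ih'

theorem presMk_eq_iff {R : Set (List A × List A)} {u v : List A} :
    presMk R u = presMk R v ↔ Relation.EqvGen (Step R) u v := by
  constructor
  · intro h
    have h' := PresentedMonoid.mk_eq_mk_iff.1 h
    change ConGen.Rel _ (FreeMonoid.ofList u) (FreeMonoid.ofList v) at h'
    suffices H : ∀ x y : FreeMonoid A,
        ConGen.Rel (fun x y : FreeMonoid A => (x.toList, y.toList) ∈ R) x y →
          Relation.EqvGen (Step R) x.toList y.toList from H _ _ h'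
    intro x y h
    induction h with
    | of x y h => exact .rel _ _ ⟨[], [], _, _, h, by simp, by simp⟩
    | refl => exact .refl _
    | symm _ ih => exact .symm _ _ ih
    | trans _ _ ih ih' => exact .trans _ _ _ ih ih'
    | @mul w x y z _ _ ih ih' =>
      refine .trans _ (x.toList ++ y.toList) _ ?_ ?_
      · simpa using eqvGen_step_append [] y.toList ih
      · simpa using eqvGen_step_append x.toList [] ih'
  · intro h
    induction h with
    | rel u v h => exact presMk_eq_of_step h
    | refl => rfl
    | symm _ _ _ ih => exact ih.symm
    | trans _ _ _ _ _ ih ih' => exact ih.trans ih'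

end Presented

/-! ### Letters that occur in no relation -/

section Blocks

variable {X : Type} (S : Set (List X × List X)) (Γ : Set X)

open Classical in
/-- The effect of the letter `g` on a pair of a list of completed blocks (the latest first) and the
value of the current block. A letter of `Γ` multiplies the current block; any other letter
completes it and is recorded beside its value. -/
noncomputable def blockStep (s : List (PresMonoid S × X) × PresMonoid S) (g : X) :
    List (PresMonoid S × X) × PresMonoid S :=
  if g ∈ Γ then (s.1, s.2 * presMk S [g]) else ((s.2, g) :: s.1, 1)

/-- The sequence of the letters of `x` outside `Γ` and of the values of the blocks between them.
If the relations involve letters of `Γ` only, it is the normal form of `x` in the free product of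
the submonoid generated by `Γ` and the free monoid on the other letters. -/
noncomputable def blockForm (x : List X) : List (PresMonoid S × X) × PresMonoid S :=
  x.foldl (blockStep S Γ) ([], 1)

variable {S Γ}

theorem foldl_blockStep {w : List X} (hw : ∀ g ∈ w, g ∈ Γ)
    (s : List (PresMonoid S × X) × PresMonoid S) :
    w.foldl (blockStep S Γ) s = (s.1, s.2 * presMk S w) := by
  induction w generalizing s with
  | nil => simp [presMk_nil]
  | cons g w ih =>
    rw [List.foldl_cons, ih fun g' h => hw g' (List.mem_cons_of_mem _ h), blockStep,
      if_pos (hw g List.mem_cons_self), mul_assoc, ← presMk_append, List.singleton_append]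

theorem blockForm_of_forall_mem {w : List X} (hw : ∀ g ∈ w, g ∈ Γ) :
    blockForm S Γ w = ([], presMk S w) := by
  simp [blockForm, foldl_blockStep hw]

theorem blockForm_append_cons {x w : List X} {g : X} (hg : g ∉ Γ) (hw : ∀ g ∈ w, g ∈ Γ) :
    blockForm S Γ (x ++ g :: w) =
      (((blockForm S Γ x).2, g) :: (blockForm S Γ x).1, presMk S w) := by
  simp [blockForm, foldl_blockStep hw, blockStep, if_neg hg]

theorem blockForm_eq_of_presMk_eq
    (hS : ∀ r ∈ S, (∀ g ∈ r.1, g ∈ Γ) ∧ ∀ g ∈ r.2, g ∈ Γ)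
    {x y : List X} (h : presMk S x = presMk S y) : blockForm S Γ x = blockForm S Γ y := by
  have h' := presMk_eq_iff.1 h
  clear h
  induction h' with
  | rel x y h =>
    obtain ⟨p, q, l, r, hlr, rfl, rfl⟩ := h
    have : presMk S l = presMk S r := PresentedMonoid.mk_eq_mk_of_rel hlr
    simp only [blockForm, List.foldl_append, foldl_blockStep (hS _ hlr).1,
      foldl_blockStep (hS _ hlr).2, this]
  | refl => rfl
  | symm _ _ _ ih => exact ih.symm
  | trans _ _ _ _ _ ih ih' => exact ih.trans ih'

theorem forall_mem_or_exists_append_cons (Γ : Set X) (x : List X) :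
    (∀ g ∈ x, g ∈ Γ) ∨ ∃ x' g w, x = x' ++ g :: w ∧ g ∉ Γ ∧ ∀ g ∈ w, g ∈ Γ := by
  induction x using List.reverseRecOn with
  | nil => simp
  | append_singleton x g ih =>
    by_cases hg : g ∈ Γ
    · rcases ih with ih | ⟨x', g', w, rfl, hg', hw⟩
      · exact .inl (by simpa [or_imp, forall_and] using ⟨ih, hg⟩)
      · exact .inr ⟨x', g', w ++ [g], by simp, hg', by
          simpa [or_imp, forall_and] using ⟨hw, hg⟩⟩
    · exact .inr ⟨x, g, [], by simp, hg, by simp⟩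

end Blocks

/-! ### Factorisation over `Σ_*` -/

section Factorisation

variable {A : Type} {α : List A}

theorem expand_append (x y : List (GammaStar α)) : expand (x ++ y) = expand x ++ expand y :=
  List.flatMap_append

theorem expand_nil : expand ([] : List (GammaStar α)) = [] := rfl

theorem expand_cons (g : GammaStar α) (x : List (GammaStar α)) :
    expand (g :: x) = g.1 ++ expand x := rfl

theorem expand_singleton (g : GammaStar α) : expand [g] = g.1 := by
  simp [expand]

/-- The symbol `γ_w` for `w = αz`. -/
def sigmaLetter {z : List A} (hz : ¬ α <:+: z) : GammaStar α := ⟨α ++ z, z, rfl, hz⟩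

/-- Every word is a product of a word without factor `α` and a word over `Σ_*`. -/
theorem exists_factorisation (hα : α ≠ []) (w : List A) :
    ∃ (p : List A) (s : List (GammaStar α)), ¬ α <:+: p ∧ w = p ++ expand s := by
  have hnil : ¬ α <:+: [] := by simpa using hα
  induction w with
  | nil => exact ⟨[], [], hnil, rfl⟩
  | cons a w ih =>
    obtain ⟨p, s, hp, rfl⟩ := ih
    by_cases h : α <:+: a :: p
    · rcases List.infix_cons_iff.1 h with ⟨z, hz⟩ | h
      · have hz' : ¬ α <:+: z := by
          intro hzα
          refine hp (hzα.trans (List.IsSuffix.isInfix ?_))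
          obtain ⟨b, α', rfl⟩ := List.exists_cons_of_ne_nil hα
          simp only [List.cons_append, List.cons.injEq] at hz
          exact ⟨α', hz.2⟩
        exact ⟨[], sigmaLetter hz' :: s, hnil, by simp [expand_cons, sigmaLetter, hz]⟩
      · exact absurd h hp
    · exact ⟨a :: p, s, h, rfl⟩

theorem exists_expand_cons (hα : α ≠ []) (q : List A) :
    ∃ (g : GammaStar α) (t : List (GammaStar α)), α ++ q = expand (g :: t) := by
  obtain ⟨p, t, hp, rfl⟩ := exists_factorisation hα q
  exact ⟨sigmaLetter hp, t, by simp [expand_cons, sigmaLetter]⟩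

theorem prefix_expand {s : List (GammaStar α)} (hs : expand s ≠ []) : α <+: expand s := by
  cases s with
  | nil => exact absurd rfl hs
  | cons g s =>
    obtain ⟨_, z, rfl, -⟩ := g
    exact ⟨z ++ expand s, by simp [expand_cons]⟩

/-- An occurrence of `α` at the beginning of `c ++ t` that is not inside `c` does not meet `c`, if
`t` is empty or begins with `α`: otherwise its part in `t` would be a self-overlap of `α`. -/
theorem eq_nil_of_prefix_append (hα : SelfOverlapFree α) {c t : List A} (hc : ¬ α <:+: c)
    (ht : t ≠ [] → α <+: t) (h : α <+: c ++ t) : c = [] := by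
  obtain ⟨z, hz⟩ := h
  rcases List.append_eq_append_iff.1 hz with ⟨e, rfl, -⟩ | ⟨e, rfl, rfl⟩
  · exact absurd (List.prefix_append α e).isInfix hc
  · by_contra hne
    by_cases hen : e = []
    · subst hen
      exact hc (by simp)
    · have hlen : e.length < (c ++ e).length := by
        have := List.length_pos_iff.2 hne
        simp only [List.length_append]
        omega
      refine hα e hen (fun h => ?_) ?_ (List.suffix_append c e)
      · rw [← h] at hlen
        exact lt_irrefl _ hlen
      · exact List.prefix_of_prefix_length_le (List.prefix_append e z)
          (ht (by simp [hen])) hlen.le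

theorem append_eq_append_of_not_infix (hα : SelfOverlapFree α) {p p' t t' : List A}
    (hp : ¬ α <:+: p) (hp' : ¬ α <:+: p') (ht : t ≠ [] → α <+: t) (ht' : t' ≠ [] → α <+: t')
    (h : p ++ t = p' ++ t') : p = p' ∧ t = t' := by
  have key : ∀ {p c t t' : List A}, ¬ α <:+: p ++ c → (t ≠ [] → α <+: t) →
      (t' ≠ [] → α <+: t') → t = c ++ t' → c = [] := by
    intro p c t t' hpc ht ht' e
    by_cases htn : t = []
    · exact (List.append_eq_nil_iff.1 (e.symm.trans htn)).1
    · exact eq_nil_of_prefix_append hα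
        (fun hc => hpc (hc.trans (List.suffix_append p c).isInfix)) ht' (e ▸ ht htn)
  rcases List.append_eq_append_iff.1 h with ⟨c, rfl, e⟩ | ⟨c, rfl, e⟩
  · obtain rfl := key hp' ht ht' e
    simpa using e
  · obtain rfl := key hp ht' ht e
    simpa using e.symm

/-- The factorisation of `exists_factorisation` is unique. -/
theorem factorisation_unique (hne : α ≠ []) (hα : SelfOverlapFree α) {p p' : List A}
    {s s' : List (GammaStar α)} (hp : ¬ α <:+: p) (hp' : ¬ α <:+: p')
    (h : p ++ expand s = p' ++ expand s') : p = p' ∧ s = s' := by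
  obtain ⟨rfl, hs⟩ := append_eq_append_of_not_infix hα hp hp' prefix_expand prefix_expand h
  refine ⟨rfl, ?_⟩
  clear hp hp' h
  induction s generalizing s' with
  | nil =>
    cases s' with
    | nil => rfl
    | cons g s' =>
      obtain ⟨_, z, rfl, _⟩ := g
      simp [expand_cons, expand_nil, hne] at hs
  | cons g s ih =>
    obtain ⟨_, z, rfl, hz⟩ := g
    cases s' with
    | nil => simp [expand_cons, expand_nil, hne] at hs
    | cons g' s' =>
      obtain ⟨_, z', rfl, hz'⟩ := g'
      simp only [expand_cons, List.append_assoc, List.append_cancel_left_eq] at hs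
      obtain ⟨rfl, ht⟩ :=
        append_eq_append_of_not_infix hα hz hz' prefix_expand prefix_expand hs
      rw [ih ht]

theorem expand_injective (hne : α ≠ []) (hα : SelfOverlapFree α) :
    Function.Injective (expand : List (GammaStar α) → List A) := by
  intro s s' h
  have hnil : ¬ α <:+: [] := by simpa using hne
  exact (factorisation_unique hne hα hnil hnil (by simpa using h)).2

theorem exists_eq_expand_append (hne : α ≠ []) (hα : SelfOverlapFree α) {l : List A}
    (h : α <+: l ∧ α <:+ l) : ∃ x : List (GammaStar α), l = expand x ++ α := by
  have hnil : ¬ α <:+: [] := by simpa using hne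
  obtain ⟨⟨q, hq⟩, ⟨m, rfl⟩⟩ := h
  obtain ⟨p, s, hp, rfl⟩ := exists_factorisation hne m
  obtain ⟨g, t, ht⟩ := exists_expand_cons hne q
  obtain ⟨rfl, -⟩ := factorisation_unique hne hα (s := s ++ [sigmaLetter hnil])
    (s' := g :: t) hp hnil (by
      rw [expand_append, expand_singleton, ← ht, hq]
      simp [sigmaLetter])
  exact ⟨s, by simp⟩

end Factorisation

/-! ### Equality in `M` and in the extended left monoid -/

section Compression

variable {A : Type} {R : Set (List A × List A)} {α : List A}

/-- The relations of the extended left monoid. -/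
abbrev leftRel (R : Set (List A × List A)) (α : List A) :
    Set (List (GammaStar α) × List (GammaStar α)) :=
  {p | (expand p.1 ++ α, expand p.2 ++ α) ∈ R}

theorem presMk_expand_eq_of_presMk_eq {x y : List (GammaStar α)}
    (h : presMk (leftRel R α) x = presMk (leftRel R α) y) :
    presMk R (expand x ++ α) = presMk R (expand y ++ α) := by
  have h' := presMk_eq_iff.1 h
  clear h
  induction h' with
  | rel x y h =>
    obtain ⟨c, d, l, r, hlr, rfl, rfl⟩ := h
    -- a word over `Σ_*` followed by `α` begins with `α`, which completes the side of the relation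
    obtain ⟨z, hz⟩ : α <+: expand d ++ α := by
      by_cases hd : expand d = []
      · simp [hd]
      · exact (prefix_expand hd).trans (List.prefix_append _ _)
    refine presMk_eq_of_step ⟨expand c, z, expand l ++ α, expand r ++ α, hlr, ?_, ?_⟩ <;>
      simp [expand_append, hz]
  | refl => rfl
  | symm _ _ _ ih => exact ih.symm
  | trans _ _ _ _ _ ih ih' => exact ih.trans ih'

/-- If two words are equal in `M`, then their factorisations agree in the part before the first
occurrence of `α` and in the last factor, and the products of the other factors are equal in the
extended left monoid. -/
theorem exists_factorisation_of_presMk_eq (h : WeaklyCompressible R α) {u v : List A}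
    (huv : presMk R u = presMk R v) :
    ∃ (p : List A) (s s' : List (GammaStar α)), ¬ α <:+: p ∧ u = p ++ expand s ∧
      v = p ++ expand s' ∧ (s = s' ∨ ∃ x y g, s = x ++ [g] ∧ s' = y ++ [g] ∧
        presMk (leftRel R α) x = presMk (leftRel R α) y) := by
  have huv' := presMk_eq_iff.1 huv
  clear huv
  induction huv' with
  | rel u v huv =>
    obtain ⟨c, d, l, r, hlr, rfl, rfl⟩ := huv
    obtain ⟨p, s, hp, rfl⟩ := exists_factorisation h.ne_nil c
    obtain ⟨x, rfl⟩ := exists_eq_expand_append h.ne_nil h.selfOverlapFree (h.sealed_rel _ _ hlr).1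
    obtain ⟨y, rfl⟩ := exists_eq_expand_append h.ne_nil h.selfOverlapFree (h.sealed_rel _ _ hlr).2
    obtain ⟨g, t, ht⟩ := exists_expand_cons h.ne_nil d
    obtain ⟨t', g', e⟩ : ∃ t' g', g :: t = t' ++ [g'] :=
      ⟨_, _, (List.dropLast_append_getLast (List.cons_ne_nil g t)).symm⟩
    refine ⟨p, s ++ x ++ (g :: t), s ++ y ++ (g :: t), hp, ?_, ?_, .inr
      ⟨s ++ x ++ t', s ++ y ++ t', g', by simp [e], by simp [e], presMk_eq_of_step ⟨s, t', x, y, hlr, rfl, rfl⟩⟩⟩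
    · simp only [expand_append, ← ht, List.append_assoc]
    · simp only [expand_append, ← ht, List.append_assoc]
  | refl u =>
    obtain ⟨p, s, hp, e⟩ := exists_factorisation h.ne_nil u
    exact ⟨p, s, s, hp, e, e, .inl rfl⟩
  | symm _ _ _ ih =>
    obtain ⟨p, s, s', hp, e, e', H⟩ := ih
    refine ⟨p, s', s, hp, e', e, H.imp Eq.symm ?_⟩
    rintro ⟨x, y, g, rfl, rfl, hxy⟩
    exact ⟨y, x, g, rfl, rfl, hxy.symm⟩
  | trans _ _ _ _ _ ih ih' =>
    obtain ⟨p, s, s', hp, rfl, e, H⟩ := ih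
    obtain ⟨p', t, t', hp', e', rfl, H'⟩ := ih'
    obtain ⟨rfl, rfl⟩ := factorisation_unique h.ne_nil h.selfOverlapFree hp hp' (e.symm.trans e')
    refine ⟨p, s, t', hp, rfl, rfl, ?_⟩
    rcases H with rfl | ⟨x, y, g, rfl, rfl, hxy⟩
    · exact H'
    · rcases H' with rfl | ⟨x', y', g', e'', rfl, hxy'⟩
      · exact .inr ⟨x, y, g, rfl, rfl, hxy⟩
      · obtain ⟨rfl, e₂⟩ := List.append_inj' e'' rfl
        obtain rfl := List.singleton_inj.1 e₂
        exact .inr ⟨x, y', g, rfl, rfl, hxy.trans hxy'⟩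

theorem presMk_expand_eq_iff (h : WeaklyCompressible R α) {x y : List (GammaStar α)} :
    presMk R (expand x ++ α) = presMk R (expand y ++ α) ↔
      presMk (leftRel R α) x = presMk (leftRel R α) y := by
  refine ⟨fun hxy => ?_, presMk_expand_eq_of_presMk_eq⟩
  have hnil : ¬ α <:+: [] := by simpa using h.ne_nil
  have e : ∀ x : List (GammaStar α), expand x ++ α = [] ++ expand (x ++ [sigmaLetter hnil]) := by
    intro x
    simp [expand_append, expand_singleton, sigmaLetter]
  obtain ⟨p, s, s', hp, hs, hs', H⟩ := exists_factorisation_of_presMk_eq h hxy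
  obtain ⟨rfl, rfl⟩ := factorisation_unique h.ne_nil h.selfOverlapFree hnil hp
    ((e x).symm.trans hs)
  obtain ⟨-, rfl⟩ := factorisation_unique h.ne_nil h.selfOverlapFree hnil hp
    ((e y).symm.trans hs')
  rcases H with H | ⟨x', y', g, hx, hy, H⟩
  · rw [List.append_cancel_right H]
  · rwa [(List.append_inj' hx rfl).1, (List.append_inj' hy rfl).1]

theorem finite_isLeftPiece (hR : R.Finite) (h : WeaklyCompressible R α) :
    {g | IsLeftPiece R α g}.Finite := by
  have key : ∀ u : List A,
      {g : GammaStar α | ∃ x : List (GammaStar α), u = expand x ++ α ∧ g ∈ x}.Finite := by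
    intro u
    by_cases hu : ∃ x : List (GammaStar α), u = expand x ++ α
    · obtain ⟨x, rfl⟩ := hu
      refine x.finite_toSet.subset ?_
      rintro g ⟨y, hy, hg⟩
      rwa [Set.mem_ofPred_eq,
        expand_injective h.ne_nil h.selfOverlapFree (List.append_cancel_right hy)]
    · convert Set.finite_empty
      ext g
      simp only [Set.mem_ofPred_eq, Set.mem_empty_iff_false, iff_false]
      rintro ⟨x, hx, -⟩
      exact hu ⟨x, hx⟩
  refine (hR.biUnion fun r _ => (key r.1).union (key r.2)).subset ?_
  rintro g ⟨u, v, x, hr, hx | hx, hg⟩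
  · exact Set.mem_biUnion hr (.inl ⟨x, hx, hg⟩)
  · exact Set.mem_biUnion hr (.inr ⟨x, hx, hg⟩)

theorem isLeftPiece_of_mem_leftRel :
    ∀ r ∈ leftRel R α, (∀ g ∈ r.1, g ∈ {g | IsLeftPiece R α g}) ∧
      ∀ g ∈ r.2, g ∈ {g | IsLeftPiece R α g} :=
  fun r hr => ⟨fun _ hg => ⟨_, _, r.1, hr, .inl rfl, hg⟩, fun _ hg => ⟨_, _, r.2, hr, .inr rfl, hg⟩⟩

end Compression

/-! ### Generating the word problem of `M` -/

section WordProblems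

variable {A : Type} {R : Set (List A × List A)} {α : List A}

theorem PairStar.mul {B : Type} {ρ : Set (List B × List B)} {u v u' v' : List B}
    (h : PairStar ρ u v) (h' : PairStar ρ u' v') : PairStar ρ (u ++ u') (v ++ v') := by
  induction h' with
  | nil => simpa using h
  | append _ hpq ih => simpa using ih.append hpq

/-- The word over `A` spelled by a word over the finite alphabet of left pieces. -/
abbrev spell (u : List {g // IsLeftPiece R α g}) : List A :=
  u.flatMap fun g => g.1.1

/-- The pairs `(uα, vα)` with `u` and `v` products of left pieces that are equal in the extended
left monoid. -/
def leftPairs (R : Set (List A × List A)) (α : List A) : Set (List A × List A) :=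
  (fun x => (spell x.1 ++ α, spell x.2 ++ α)) ''
    {x : List {g // IsLeftPiece R α g} × List {g // IsLeftPiece R α g} |
      presMk (leftRel R α) (x.1.map Subtype.val) = presMk (leftRel R α) (x.2.map Subtype.val)}

/-- The pairs `(a, a)` with `a` a letter. -/
def letterPairs (A : Type) : Set (List A × List A) :=
  Set.range fun a => ([a], [a])

theorem expand_map_val (u : List {g // IsLeftPiece R α g}) :
    expand (u.map Subtype.val) = spell u := by
  simp [expand, List.flatMap_map]

theorem pairStar_refl (u : List A) : PairStar (leftPairs R α ∪ letterPairs A) u u := by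
  induction u using List.reverseRecOn with
  | nil => exact .nil
  | append_singleton u a ih => exact ih.append (.inr ⟨a, rfl⟩)

theorem pairStar_of_isLeftPiece {x y : List (GammaStar α)}
    (hx : ∀ g ∈ x, g ∈ {g | IsLeftPiece R α g}) (hy : ∀ g ∈ y, g ∈ {g | IsLeftPiece R α g})
    (h : presMk (leftRel R α) x = presMk (leftRel R α) y) :
    PairStar (leftPairs R α ∪ letterPairs A) (expand x ++ α) (expand y ++ α) := by
  lift x to List {g // IsLeftPiece R α g} using hx
  lift y to List {g // IsLeftPiece R α g} using hy
  rw [expand_map_val, expand_map_val]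
  exact PairStar.append (u := []) (v := []) .nil (.inl ⟨(x, y), h, rfl⟩)

/-- Words `u₀ (α z₁) u₁ ⋯ (α zₖ) uₖ α`, in which the `uᵢ` are products of left pieces and the
`α zᵢ ∈ Σ_*` are not left pieces, are products of the words `uᵢ α` and `zᵢ`. -/
theorem pairStar_of_blockForm_eq {x y : List (GammaStar α)}
    (h : blockForm (leftRel R α) {g | IsLeftPiece R α g} x =
      blockForm (leftRel R α) {g | IsLeftPiece R α g} y) :
    PairStar (leftPairs R α ∪ letterPairs A) (expand x ++ α) (expand y ++ α) := by
  induction hn : x.length using Nat.strong_induction_on generalizing x y with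
  | _ n ih =>
    subst hn
    rcases forall_mem_or_exists_append_cons {g | IsLeftPiece R α g} x with
      hx | ⟨x, g, w, rfl, hg, hw⟩ <;>
    rcases forall_mem_or_exists_append_cons {g | IsLeftPiece R α g} y with
      hy | ⟨y, g', w', rfl, hg', hw'⟩
    · rw [blockForm_of_forall_mem hx, blockForm_of_forall_mem hy] at h
      exact pairStar_of_isLeftPiece hx hy (Prod.mk.inj h).2
    · rw [blockForm_of_forall_mem hx, blockForm_append_cons hg' hw'] at h
      simp at h
    · rw [blockForm_append_cons hg hw, blockForm_of_forall_mem hy] at h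
      simp at h
    · rw [blockForm_append_cons hg hw, blockForm_append_cons hg' hw'] at h
      simp only [Prod.mk.injEq, List.cons.injEq] at h
      obtain ⟨⟨⟨h₂, rfl⟩, h₁⟩, h₃⟩ := h
      have hxy := ih x.length (by simp) (Prod.ext h₁ h₂) rfl
      obtain ⟨_, z, rfl, _⟩ := g
      simpa [expand_append, expand_cons] using
        hxy.mul ((pairStar_refl z).mul (pairStar_of_isLeftPiece hw hw' h₃))

theorem presMk_eq_iff_pairStar (h : WeaklyCompressible R α) {u v : List A} :
    presMk R u = presMk R v ↔ PairStar (leftPairs R α ∪ letterPairs A) u v := by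
  constructor
  · intro huv
    obtain ⟨p, s, s', -, rfl, rfl, rfl | ⟨x, y, g, rfl, rfl, hxy⟩⟩ :=
      exists_factorisation_of_presMk_eq h huv
    · exact pairStar_refl _
    · obtain ⟨_, z, rfl, _⟩ := g
      simpa [expand_append, expand_singleton] using
        (pairStar_refl p).mul ((pairStar_of_blockForm_eq (blockForm_eq_of_presMk_eq
          isLeftPiece_of_mem_leftRel hxy)).mul (pairStar_refl z))
  · intro huv
    induction huv with
    | nil => rfl
    | append _ hpq ih =>
      rw [presMk_append, presMk_append, ih]
      congr 1
      rcases hpq with ⟨⟨x, y⟩, hxy, e⟩ | ⟨a, e⟩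
      · obtain ⟨rfl, rfl⟩ := Prod.mk.inj e
        rw [← expand_map_val, ← expand_map_val]
        exact presMk_expand_eq_of_presMk_eq hxy
      · obtain ⟨rfl, rfl⟩ := Prod.mk.inj e
        rfl

end WordProblems

/-! ### Transfer of the word problem -/

section Transfer

variable {A : Type} {R : Set (List A × List A)} {α : List A} {C : LanguageClass}

theorem apply_flatMap_ofList {B B' M : Type*} [Monoid M] (π : FreeMonoid B →* M)
    (f : B' → List B) (u : List B') :
    π (FreeMonoid.ofList (u.flatMap f)) = (u.map fun b => π (FreeMonoid.ofList (f b))).prod := by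
  induction u with
  | nil => exact map_one π
  | cons b u ih =>
    rw [List.flatMap_cons, FreeMonoid.ofList_append, map_mul, ih, List.map_cons, List.prod_cons]

/-- Inverse homomorphisms change the generators of the left monoid to the left pieces. -/
theorem pairLanguage_leftMonoid_mem [Finite {g // IsLeftPiece R α g}] (hC : IsAFL C)
    (hL : HasWordProblemIn C (leftMonoid R α)) :
    pairLanguage {x : List {g // IsLeftPiece R α g} × List {g // IsLeftPiece R α g} |
      presMk (leftRel R α) (x.1.map Subtype.val) = presMk (leftRel R α) (x.2.map Subtype.val)} ∈
        C (Option {g // IsLeftPiece R α g}) := by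
  obtain ⟨B, _, π, hπ, hB⟩ := hL
  have hf : ∀ g : {g // IsLeftPiece R α g}, ∃ b : List B,
      (π (FreeMonoid.ofList b) : ExtLeftMonoid R α) = presMk (leftRel R α) [g.1] := by
    intro g
    obtain ⟨b, hb⟩ := hπ ⟨presMk (leftRel R α) [g.1], Submonoid.subset_closure ⟨g.1, g.2, rfl⟩⟩
    exact ⟨b.toList, congrArg Subtype.val hb⟩
  choose f hf using hf
  have key : ∀ u : List {g // IsLeftPiece R α g},
      (π (FreeMonoid.ofList (u.flatMap f ++ [])) : ExtLeftMonoid R α) =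
        presMk (leftRel R α) (u.map Subtype.val) := by
    intro u
    rw [List.append_nil, ← List.flatMap_pure_eq_map, presMk_flatMap, apply_flatMap_ofList,
      Submonoid.coe_list_prod, List.map_map]
    congr 1
    exact List.map_congr_left fun g _ => hf g
  rw [wordProblem_eq_pairLanguage] at hB
  convert pairLanguage_comap_mem hC hB f [] [] using 2
  ext x
  rw [Set.mem_ofPred_eq, ← key, ← key]
  exact Subtype.ext_iff.symm

/-- The word problem of `M` encodes the submonoid of `A* × A*` generated by finitely many pairs and
the image of the word problem of the left monoid. -/
theorem hasWordProblemIn_of_leftMonoid [Finite A] (hC : IsSuperAFL C) (hR : R.Finite)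
    (h : WeaklyCompressible R α) (hL : HasWordProblemIn C (leftMonoid R α)) :
    HasWordProblemIn C (PresMonoid R) := by
  have : Finite {g // IsLeftPiece R α g} := finite_isLeftPiece hR h
  have hJ : pairLanguage (leftPairs R α) ∈ C (Option A) :=
    pairLanguage_image_mem hC.isAFL (pairLanguage_leftMonoid_mem hC.isAFL hL) _ α α
  have hne : (leftPairs R α).Nonempty := ⟨_, ([], []), rfl, rfl⟩
  refine ⟨A, inferInstance, PresentedMonoid.mk _, PresentedMonoid.surjective_mk, ?_⟩
  rw [wordProblem_eq_pairLanguage]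
  convert pairLanguage_pairStar_mem hC (pairLanguage_union_finite_mem hC.isAFL hJ hne
    (Set.finite_range fun a : A => ([a], [a]))) (hne.mono Set.subset_union_left) using 2
  ext x
  exact presMk_eq_iff_pairStar h

/-- As `u = v` in the left monoid exactly if `uα = vα` in `M`, substituting the left pieces and
inserting `α` on both sides of `#` reduces its word problem to that of `M`. -/
theorem hasWordProblemIn_leftMonoid (hC : IsAFL C) (hR : R.Finite)
    (h : WeaklyCompressible R α) (hM : HasWordProblemIn C (PresMonoid R)) :
    HasWordProblemIn C (leftMonoid R α) := by
  obtain ⟨B, _, π, hπ, hB⟩ := hM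
  have : Finite {g // IsLeftPiece R α g} := finite_isLeftPiece hR h
  have hf : ∀ w : List A, ∃ b : List B, π (FreeMonoid.ofList b) = presMk R w :=
    fun w => (hπ _).imp fun b hb => hb
  choose f hf using hf
  have key : ∀ u : List {g // IsLeftPiece R α g},
      π (FreeMonoid.ofList (u.flatMap (fun g => f g.1.1) ++ f α)) =
        presMk R (expand (u.map Subtype.val) ++ α) := by
    intro u
    rw [expand_map_val, presMk_append, presMk_flatMap, FreeMonoid.ofList_append, map_mul,
      apply_flatMap_ofList]
    simp only [hf]
  let of' : {g // IsLeftPiece R α g} → leftMonoid R α := fun g =>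
    ⟨presMk (leftRel R α) [g.1], Submonoid.subset_closure ⟨g.1, g.2, rfl⟩⟩
  have hval : ∀ u : List {g // IsLeftPiece R α g},
      (FreeMonoid.lift of' (FreeMonoid.ofList u) : ExtLeftMonoid R α) =
        presMk (leftRel R α) (u.map Subtype.val) := by
    intro u
    rw [← List.flatMap_pure_eq_map, presMk_flatMap, FreeMonoid.lift_apply,
      Submonoid.coe_list_prod, List.map_map]
    rfl
  refine ⟨{g // IsLeftPiece R α g}, this, FreeMonoid.lift of', ?_, ?_⟩
  · rintro ⟨m, hm⟩
    suffices H : ∃ u : List {g // IsLeftPiece R α g},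
        presMk (leftRel R α) (u.map Subtype.val) = m by
      obtain ⟨u, rfl⟩ := H
      exact ⟨FreeMonoid.ofList u, Subtype.ext (hval u)⟩
    induction hm using Submonoid.closure_induction with
    | mem m hm =>
      obtain ⟨g, hg, rfl⟩ := hm
      exact ⟨[⟨g, hg⟩], rfl⟩
    | one => exact ⟨[], rfl⟩
    | mul m m' _ _ ih ih' =>
      obtain ⟨u, rfl⟩ := ih
      obtain ⟨u', rfl⟩ := ih'
      exact ⟨u ++ u', by rw [List.map_append, presMk_append]⟩
  · rw [wordProblem_eq_pairLanguage] at hB ⊢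
    convert pairLanguage_comap_mem hC hB (fun g : {g // IsLeftPiece R α g} => f g.1.1)
      (f α) (f α) using 2
    ext x
    refine Subtype.ext_iff.trans ?_
    rw [hval, hval, ← presMk_expand_eq_iff h, ← key, ← key]
    rfl

end Transfer

end WeakCompression

theorem theorem1 (C : WeakCompression.LanguageClass)
    (hC : WeakCompression.IsSuperAFL C) (hrev : WeakCompression.ReversalClosed C)
    {A : Type} [Finite A] (R : Set (List A × List A)) (hR : R.Finite)
    (α : List A) (hα : WeakCompression.WeaklyCompressible R α) :
    WeakCompression.HasWordProblemIn C (WeakCompression.PresMonoid R) ↔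
      WeakCompression.HasWordProblemIn C (WeakCompression.leftMonoid R α) :=
  ⟨WeakCompression.hasWordProblemIn_leftMonoid hC.isAFL hR hα,
    WeakCompression.hasWordProblemIn_of_leftMonoid hC hR hα⟩
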